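/- For a permutation $w=w(1)\cdots w(n)$ of $[n]=\{1,\dots,n\}$, let $\mathrm{Pin}(w)=\{w(i) : 1<i<n,\ w(i-1)<w(i)>w(i+1)\}$ be its pinnacle set, and for a set $S$ let $p_S(n)=|\{w\in S_n : \mathrm{Pin}(w)=S\}|$. A set $S$ is called admissible if $S=\mathrm{Pin}(w)$ for some $m$ and some $w\in S_m$. Let $d$ and $n$ be positive integers with $2d<n$. Then for every admissible pinnacle set $S\subseteq[n]$ with $|S|=d$, $$2^{n-d-1}\;\le\; p_S(n)\;\le\; d!\,(d+1)!\,2^{n-2d-1}\,S(n-d,d+1),$$ where $S(\cdot,\cdot)$ denotes the Stirling number of the second kind. Both bounds are sharp: the sets $M_d=\{3,5,\dots,2d+1\}$ and $\{n-d+1,\dots,n\}$ are admissible $d$-element subsets of $[n]$; the lower bound is attained by $S=M_d$ and the upper bound by $S=\{n-d+1,\dots,n\}$. -/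

import Mathlib

/-- The peak set `Pk(w)` of a permutation `w` of `Fin n`: the positions `i` that have both a left
neighbour `a` and a right neighbour `b`, with `w a < w i > w b`. -/
def peakSet {n : ℕ} (w : Equiv.Perm (Fin n)) : Finset (Fin n) :=
  Finset.univ.filter fun i =>
    ∃ a b : Fin n, (a : ℕ) + 1 = i ∧ (i : ℕ) + 1 = b ∧ w a < w i ∧ w b < w i

/-- The pinnacle set `Pin(w) = {w(i) : i ∈ Pk(w)}`. The element `k : Fin n` stands for the number
`k + 1` of `[n] = {1, …, n}`, so this is a set of positive integers contained in `[n]`. -/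
def pinnacleSet {n : ℕ} (w : Equiv.Perm (Fin n)) : Finset ℕ :=
  (peakSet w).image fun i => (w i : ℕ) + 1

/-- `S` is `n`-admissible if it is the pinnacle set of some permutation in `S_n`. -/
def IsNAdmissible (n : ℕ) (S : Finset ℕ) : Prop :=
  ∃ w : Equiv.Perm (Fin n), pinnacleSet w = S

/-- `S` is an admissible pinnacle set if it is `n`-admissible for some `n`. -/
def IsAdmissible (S : Finset ℕ) : Prop :=
  ∃ n : ℕ, IsNAdmissible n S

/-- `p_S(n)`: the number of permutations `w` in `S_n` with `Pin(w) = S`. -/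
def pinnacleCount (S : Finset ℕ) (n : ℕ) : ℕ :=
  (Finset.univ.filter fun w : Equiv.Perm (Fin n) => pinnacleSet w = S).card

/-- The set `M_d = {3, 5, …, 2d + 1}`. -/
def minimalPinnacles (d : ℕ) : Finset ℕ :=
  (Finset.Icc 1 d).image fun k => 2 * k + 1

/-- The set `{n - d + 1, …, n}` of the `d` largest elements of `[n]` (used for `d ≤ n`). -/
def maximalPinnacles (n d : ℕ) : Finset ℕ :=
  Finset.Icc (n - d + 1) n

/-!
The permutations with a given pinnacle set are counted by building the word `w(1) ⋯ w(n)` letter by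
letter, in increasing order. The letters `1, …, k` of the word form a set of blocks of consecutive
letters. The letter `k + 1` either joins two blocks, and then it is a pinnacle, or it does not become
a pinnacle: it is attached to an end of one block, or it forms a new block. With `c` blocks present
after this step, there are `(c + 1) c`, `2 c` and `1` ways respectively, so the number of sets of `c`
words on `1, …, k` with pinnacles in `S` satisfies the recursion `familyCount`, and
`pinnacleCount S n = familyCount S n 1` (`pinnacleCount_eq_familyCount`). In the proof the words are
labelled by a finite set of indices, which makes joining and cutting words operations on functions
`ℕ → List ℕ` that need no reindexing (`encard_isArrangement`).

The bounds are read off from the recursion. A nonzero product of these weights has a factor at least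
`2` for every letter except the `d + 1` letters that form a new block, which gives the lower bound
(`two_pow_le_familyCount`). A join becomes more productive if it is delayed, so the count is largest
if the pinnacles are the `d` largest letters (`familyCount_le_of_card`); in this case the first
`n - d` letters form `d + 1` blocks without pinnacles, which is where the Stirling number comes from
(`familyCount_empty`), and the joins contribute the product of the weights
`(c + 1) c` for `c = 1, …, d`, which is `d! (d + 1)!`. For `{3, 5, …, 2d + 1}` there is a single
block after each pinnacle, and the recursion can be solved (`familyCount_minimalPinnacles`).
-/

/-! ### Pinnacles of words -/

/-- `x` is a pinnacle of the word `l`: it occurs in `l` strictly between two smaller neighbours.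
The first and the last letter of a word are never pinnacles. -/
def IsPinnacle (x : ℕ) (l : List ℕ) : Prop :=
  ∃ a b, [a, x, b] <:+: l ∧ a < x ∧ b < x

theorem not_isPinnacle_nil (x : ℕ) : ¬ IsPinnacle x [] := by
  rintro ⟨a, b, h, -⟩
  simpa using h.length_le

theorem IsPinnacle.mem {x : ℕ} {l : List ℕ} (h : IsPinnacle x l) : x ∈ l := by
  obtain ⟨a, b, h, -⟩ := h
  exact h.subset (by simp)

theorem IsPinnacle.of_infix {x : ℕ} {l l' : List ℕ} (h : IsPinnacle x l) (hl : l <:+: l') :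
    IsPinnacle x l' := by
  obtain ⟨a, b, h, h'⟩ := h
  exact ⟨a, b, h.trans hl, h'⟩

/-- Joining two words by a letter `k` larger than all of theirs keeps their pinnacles, and makes
`k` a new pinnacle exactly when both words are nonempty. -/
theorem isPinnacle_append_cons {x k : ℕ} {u v : List ℕ} (hu : ∀ y ∈ u, y < k)
    (hv : ∀ y ∈ v, y < k) :
    IsPinnacle x (u ++ k :: v) ↔
      IsPinnacle x u ∨ IsPinnacle x v ∨ (x = k ∧ u ≠ [] ∧ v ≠ []) := by
  constructor
  · rintro ⟨a, b, ⟨p, q, h⟩, ha, hb⟩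
    simp only [List.append_assoc, List.cons_append, List.nil_append] at h
    rw [List.append_eq_append_iff] at h
    rcases h with ⟨s, rfl, h⟩ | ⟨s, rfl, h⟩
    · match s, h with
      | [], h =>
        simp only [List.nil_append, List.cons.injEq] at h
        obtain ⟨rfl, rfl⟩ := h
        have := hv x (by simp)
        omega
      | [_], h =>
        simp only [List.cons_append, List.nil_append, List.cons.injEq] at h
        obtain ⟨rfl, rfl, rfl⟩ := h
        simp
      | [_, _], h =>
        simp only [List.cons_append, List.nil_append, List.cons.injEq] at h
        obtain ⟨rfl, rfl, rfl, rfl⟩ := h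
        have := hu x (by simp)
        omega
      | _ :: _ :: _ :: s, h =>
        simp only [List.cons_append, List.cons.injEq] at h
        obtain ⟨rfl, rfl, rfl, rfl⟩ := h
        exact Or.inl ⟨a, b, ⟨p, s, by simp⟩, ha, hb⟩
    · match s, h with
      | [], h =>
        simp only [List.nil_append, List.cons.injEq] at h
        obtain ⟨rfl, rfl⟩ := h
        have := hv x (by simp)
        omega
      | _ :: s, h =>
        simp only [List.cons_append, List.cons.injEq] at h
        obtain ⟨rfl, rfl⟩ := h
        exact Or.inr (Or.inl ⟨a, b, ⟨s, q, by simp⟩, ha, hb⟩)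
  · rintro (h | h | ⟨rfl, hu0, hv0⟩)
    · exact h.of_infix ⟨[], k :: v, by simp⟩
    · exact h.of_infix ⟨u ++ [k], [], by simp⟩
    · obtain ⟨b, v, rfl⟩ := List.exists_cons_of_ne_nil hv0
      obtain ⟨u, a, rfl⟩ := List.eq_nil_or_concat u |>.resolve_left hu0
      exact ⟨a, b, ⟨u, v, by simp⟩, hu a (by simp), hv b (by simp)⟩

/-! ### Families of words -/

/-- The family of words `f` is an arrangement of the letters `1, …, k`, each used once, whose
nonempty words are those labelled by `I` and whose pinnacles are the elements of `S` in `[1, k]`. -/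
structure IsArrangement (S : Finset ℕ) (k : ℕ) (I : Finset ℕ) (f : ℕ → List ℕ) : Prop where
  nonempty_iff : ∀ i, f i ≠ [] ↔ i ∈ I
  nodup : ∀ i, (f i).Nodup
  unique : ∀ i j x, x ∈ f i → x ∈ f j → i = j
  letters : ∀ x, (∃ i, x ∈ f i) ↔ 1 ≤ x ∧ x ≤ k
  pinnacles : ∀ x, (∃ i, IsPinnacle x (f i)) ↔ x ∈ S ∧ 1 ≤ x ∧ x ≤ k

/-- Replace the `j`-th word `u` by `u ++ k :: v`, where `v` is the `o`-th word, which becomes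
empty. -/
def joinWords (k j o : ℕ) (f : ℕ → List ℕ) : ℕ → List ℕ :=
  Function.update (Function.update f j (f j ++ k :: f o)) o []

theorem joinWords_left {k j o : ℕ} (hjo : j ≠ o) (f : ℕ → List ℕ) :
    joinWords k j o f j = f j ++ k :: f o := by
  simp [joinWords, hjo]

theorem joinWords_right (k j o : ℕ) (f : ℕ → List ℕ) : joinWords k j o f o = [] := by
  simp [joinWords]

theorem joinWords_of_ne {k j o i : ℕ} (hj : i ≠ j) (ho : i ≠ o) (f : ℕ → List ℕ) :
    joinWords k j o f i = f i := by
  simp [joinWords, hj, ho]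

namespace IsArrangement

variable {S I J : Finset ℕ} {k j o : ℕ} {f g : ℕ → List ℕ}

theorem lt_succ (hf : IsArrangement S k I f) {i x : ℕ} (hx : x ∈ f i) : x < k + 1 := by
  have := (hf.letters x).1 ⟨i, hx⟩
  omega

theorem succ_notMem (hf : IsArrangement S k I f) (i : ℕ) : k + 1 ∉ f i :=
  fun h => lt_irrefl _ (hf.lt_succ h)

theorem join (hf : IsArrangement S k J f) (hjo : j ≠ o) (hj : j ∈ I) (ho : o ∉ I)
    (hIJ : ∀ i, i ≠ j → i ≠ o → (i ∈ J ↔ i ∈ I)) (hS : (j ∈ J ∧ o ∈ J) ↔ k + 1 ∈ S) :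
    IsArrangement S (k + 1) I (joinWords (k + 1) j o f) := by
  have mem : ∀ i x, x ∈ joinWords (k + 1) j o f i ↔
      (i = j ∧ (x ∈ f j ∨ x = k + 1 ∨ x ∈ f o)) ∨ (i ≠ j ∧ i ≠ o ∧ x ∈ f i) := by
    intro i x
    by_cases hi : i = j
    · subst hi; simp [joinWords_left hjo]
    · by_cases hi' : i = o
      · subst hi'; simp [joinWords_right, hi]
      · simp [joinWords_of_ne hi hi', hi, hi']
  refine ⟨fun i => ?_, fun i => ?_, fun i i' x hx hx' => ?_, fun x => ?_, fun x => ?_⟩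
  · by_cases hi : i = j
    · subst hi; simp [joinWords_left hjo, hj]
    · by_cases hi' : i = o
      · subst hi'; simp [joinWords_right, ho]
      · rw [joinWords_of_ne hi hi', hf.nonempty_iff, hIJ i hi hi']
  · by_cases hi : i = j
    · subst hi
      rw [joinWords_left hjo, List.nodup_append]
      refine ⟨hf.nodup i, List.nodup_cons.2 ⟨hf.succ_notMem o, hf.nodup o⟩, ?_⟩
      rintro a ha b hb rfl
      rcases List.mem_cons.1 hb with rfl | hb
      · exact hf.succ_notMem _ ha
      · exact hjo (hf.unique _ _ _ ha hb)
    · by_cases hi' : i = o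
      · subst hi'; simp [joinWords_right]
      · rw [joinWords_of_ne hi hi']; exact hf.nodup i
  · rw [mem] at hx hx'
    have h1 := hf.unique
    have h2 := hf.succ_notMem
    grind
  · have h1 := hf.letters x
    simp only [mem]
    constructor
    · rintro ⟨i, ⟨rfl, h | h | h⟩ | ⟨-, -, h⟩⟩
      · have := h1.1 ⟨_, h⟩; omega
      · omega
      · have := h1.1 ⟨_, h⟩; omega
      · have := h1.1 ⟨_, h⟩; omega
    · rintro ⟨hx1, hx2⟩
      by_cases hx : x = k + 1
      · exact ⟨j, by simp [hx]⟩
      · obtain ⟨i, hi⟩ := h1.2 ⟨hx1, by omega⟩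
        by_cases hij : i = j ∨ i = o
        · exact ⟨j, by grind⟩
        · exact ⟨i, by grind⟩
  · have h1 := hf.pinnacles x
    have hpin : (∃ i, IsPinnacle x (joinWords (k + 1) j o f i)) ↔
        (∃ i, IsPinnacle x (f i)) ∨ (x = k + 1 ∧ j ∈ J ∧ o ∈ J) := by
      have hj' := isPinnacle_append_cons (x := x) (fun y hy => hf.lt_succ (i := j) hy)
        (fun y hy => hf.lt_succ (i := o) hy)
      rw [hf.nonempty_iff, hf.nonempty_iff] at hj'
      constructor
      · rintro ⟨i, hi⟩
        by_cases hij : i = j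
        · subst hij
          rw [joinWords_left hjo, hj'] at hi
          grind
        · by_cases hio : i = o
          · subst hio
            rw [joinWords_right] at hi
            exact absurd hi (not_isPinnacle_nil x)
          · rw [joinWords_of_ne hij hio] at hi
            exact Or.inl ⟨i, hi⟩
      · rintro (⟨i, hi⟩ | h)
        · by_cases hij : i = j ∨ i = o
          · refine ⟨j, ?_⟩
            rw [joinWords_left hjo, hj']
            grind
          · exact ⟨i, by rw [joinWords_of_ne (by tauto) (by tauto)]; exact hi⟩
        · exact ⟨j, by rw [joinWords_left hjo, hj']; exact Or.inr (Or.inr h)⟩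
    rw [hpin, h1, hS]
    grind

/-- Every arrangement of `1, …, k + 1` arises from `joinWords`: cut the word that contains `k + 1`
at this letter. -/
theorem exists_joinWords_eq (hg : IsArrangement S (k + 1) I g) (hj : k + 1 ∈ g j) (ho : o ∉ I) :
    ∃ f J, IsArrangement S k J f ∧ joinWords (k + 1) j o f = g ∧
      (∀ i, i ≠ j → i ≠ o → (i ∈ J ↔ i ∈ I)) ∧ ((j ∈ J ∧ o ∈ J) ↔ k + 1 ∈ S) := by
  obtain ⟨u, v, huv⟩ := List.append_of_mem hj
  have hjI : j ∈ I := (hg.nonempty_iff j).1 (List.ne_nil_of_mem hj)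
  have hjo : j ≠ o := by rintro rfl; exact ho hjI
  have hgo : g o = [] := by
    by_contra h
    exact ho ((hg.nonempty_iff o).1 h)
  have hnd := hg.nodup j
  rw [huv, List.nodup_append, List.nodup_cons] at hnd
  obtain ⟨hu, ⟨hkv, hv⟩, hdisj⟩ := hnd
  have hku : k + 1 ∉ u := fun h => hdisj _ h _ (by simp) rfl
  set f : ℕ → List ℕ := Function.update (Function.update g j u) o v with hfdef
  have fj : f j = u := by simp [f, hjo]
  have fo : f o = v := by simp [f]
  have fne : ∀ i, i ≠ j → i ≠ o → f i = g i := fun i h h' => by simp [f, h, h']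
  have hle : ∀ y ∈ g j, y ≤ k + 1 := fun y hy => ((hg.letters y).1 ⟨j, hy⟩).2
  have hult : ∀ y ∈ u, y < k + 1 := fun y hy =>
    lt_of_le_of_ne (hle y (by simp [huv, hy])) (by rintro rfl; exact hku hy)
  have hvlt : ∀ y ∈ v, y < k + 1 := fun y hy =>
    lt_of_le_of_ne (hle y (by simp [huv, hy])) (by rintro rfl; exact hkv hy)
  have hpin := fun x => isPinnacle_append_cons (x := x) hult hvlt
  rw [← huv] at hpin
  have hkmem : ∀ i, k + 1 ∈ g i → i = j := fun i hi => hg.unique _ _ _ hi hj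
  have hkS : k + 1 ∈ S ↔ u ≠ [] ∧ v ≠ [] := by
    have h := hg.pinnacles (k + 1)
    have h' : (∃ i, IsPinnacle (k + 1) (g i)) ↔ IsPinnacle (k + 1) (g j) :=
      ⟨fun ⟨i, hi⟩ => hkmem i hi.mem ▸ hi, fun h => ⟨j, h⟩⟩
    rw [h', hpin] at h
    have a1 : ¬ IsPinnacle (k + 1) u := fun h => hku h.mem
    have a2 : ¬ IsPinnacle (k + 1) v := fun h => hkv h.mem
    grind
  have hmem : ∀ i x, x ∈ f i → x ∈ g i ∨ (i = o ∧ x ∈ g j) := by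
    intro i x hx
    by_cases hij : i = j
    · subst hij; rw [fj] at hx; exact Or.inl (by simp [huv, hx])
    · by_cases hio : i = o
      · subst hio; rw [fo] at hx; exact Or.inr ⟨rfl, by simp [huv, hx]⟩
      · exact Or.inl (fne i hij hio ▸ hx)
  have hkf : ∀ i, k + 1 ∉ f i := by
    intro i hi
    by_cases hij : i = j
    · subst hij; exact hku (fj ▸ hi)
    · by_cases hio : i = o
      · subst hio; exact hkv (fo ▸ hi)
      · exact hij (hkmem i (fne i hij hio ▸ hi))
  refine ⟨f, (insert o I).filter fun i => f i ≠ [], ⟨fun i => ?_, fun i => ?_, ?_, ?_, ?_⟩,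
    ?_, ?_, ?_⟩
  · by_cases hij : i = j
    · subst hij; simp [hjI]
    · by_cases hio : i = o
      · subst hio; simp
      · have := hg.nonempty_iff i
        simp only [Finset.mem_filter, Finset.mem_insert, hio, false_or, fne i hij hio]
        tauto
  · by_cases hij : i = j
    · subst hij; rw [fj]; exact hu
    · by_cases hio : i = o
      · subst hio; rw [fo]; exact hv
      · rw [fne i hij hio]; exact hg.nodup i
  · intro i i' x hx hx'
    have h1 := hg.unique
    have hgj : ∀ x, x ∈ g j ↔ x ∈ u ∨ x = k + 1 ∨ x ∈ v := by simp [huv]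
    by_cases hij : i = j <;> by_cases hio : i = o <;> by_cases hij' : i' = j <;>
      by_cases hio' : i' = o <;> grind
  · intro x
    constructor
    · rintro ⟨i, hi⟩
      have h1 : x ≠ k + 1 := by rintro rfl; exact hkf i hi
      have h2 : 1 ≤ x ∧ x ≤ k + 1 := by
        rcases hmem i x hi with h | ⟨-, h⟩
        · exact (hg.letters x).1 ⟨_, h⟩
        · exact (hg.letters x).1 ⟨_, h⟩
      omega
    · rintro ⟨h1, h2⟩
      obtain ⟨i, hi⟩ := (hg.letters x).2 ⟨h1, by omega⟩
      by_cases hij : i = j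
      · subst hij
        have : x ≠ k + 1 := by omega
        simp only [huv, List.mem_append, List.mem_cons, this, false_or] at hi
        rcases hi with hi | hi
        · exact ⟨i, fj.symm ▸ hi⟩
        · exact ⟨o, fo.symm ▸ hi⟩
      · have hio : i ≠ o := by rintro rfl; simp [hgo] at hi
        exact ⟨i, (fne i hij hio).symm ▸ hi⟩
  · intro x
    have hp := hg.pinnacles x
    constructor
    · rintro ⟨i, hi⟩
      have h1 : x ≠ k + 1 := by rintro rfl; exact hkf i hi.mem
      have h2 : x ∈ S ∧ 1 ≤ x ∧ x ≤ k + 1 := by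
        apply hp.1
        by_cases hij : i = j
        · subst hij; exact ⟨i, (hpin x).2 (Or.inl (fj ▸ hi))⟩
        · by_cases hio : i = o
          · subst hio; exact ⟨j, (hpin x).2 (Or.inr (Or.inl (fo ▸ hi)))⟩
          · exact ⟨i, fne i hij hio ▸ hi⟩
      exact ⟨h2.1, h2.2.1, by omega⟩
    · rintro ⟨h0, h1, h2⟩
      obtain ⟨i, hi⟩ := hp.2 ⟨h0, h1, by omega⟩
      by_cases hij : i = j
      · subst hij
        rcases (hpin x).1 hi with hi | hi | hi
        · exact ⟨i, fj.symm ▸ hi⟩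
        · exact ⟨o, fo.symm ▸ hi⟩
        · omega
      · have hio : i ≠ o := by
          rintro rfl
          rw [hgo] at hi
          exact not_isPinnacle_nil x hi
        exact ⟨i, (fne i hij hio).symm ▸ hi⟩
  · funext i
    by_cases hij : i = j
    · subst hij; rw [joinWords_left hjo, fj, fo, huv]
    · by_cases hio : i = o
      · subst hio; rw [joinWords_right, hgo]
      · rw [joinWords_of_ne hij hio, fne i hij hio]
  · intro i hij hio
    have := hg.nonempty_iff i
    simp only [Finset.mem_filter, Finset.mem_insert, hio, false_or, fne i hij hio]
    tauto
  · rw [hkS]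
    simp [fj, fo, hjI]

theorem joinWords_injOn (hjo : j ≠ o) :
    Set.InjOn (joinWords k j o) {f | ∀ i, k ∉ f i} := by
  intro f hf g hg h
  have hj := congrFun h j
  rw [joinWords_left hjo, joinWords_left hjo] at hj
  have hcut := (List.append_cons_inj_of_notMem (hf j) (hf o)).1 hj
  funext i
  by_cases hij : i = j
  · subst hij; exact hcut.1
  · by_cases hio : i = o
    · subst hio; exact hcut.2.2
    · have := congrFun h i
      rwa [joinWords_of_ne hij hio, joinWords_of_ne hij hio] at this

end IsArrangement

/-! ### Counting arrangements -/

/-- The number of sets of `c` nonempty words that use each of the letters `1, …, k` once and whose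
pinnacles are the elements of `S` in `[1, k]`, by recursion on the largest letter. If it is a
pinnacle, it joins an ordered pair of words; otherwise it is a word of its own, or it is attached to
one of the two ends of a word. -/
def familyCount (S : Finset ℕ) : ℕ → ℕ → ℕ
  | 0, 0 => 1
  | 0, _ + 1 => 0
  | k + 1, c =>
    if k + 1 ∈ S then (c + 1) * c * familyCount S k (c + 1)
    else match c with
      | 0 => 0
      | c + 1 => familyCount S k c + 2 * (c + 1) * familyCount S k (c + 1)

theorem familyCount_succ_of_mem {S : Finset ℕ} {k : ℕ} (h : k + 1 ∈ S) (c : ℕ) :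
    familyCount S (k + 1) c = (c + 1) * c * familyCount S k (c + 1) := by
  cases c <;> rw [familyCount, if_pos h]

theorem familyCount_succ_of_notMem {S : Finset ℕ} {k : ℕ} (h : k + 1 ∉ S) (c : ℕ) :
    familyCount S (k + 1) (c + 1) =
      familyCount S k c + 2 * (c + 1) * familyCount S k (c + 1) := by
  rw [familyCount, if_neg h]

theorem familyCount_succ_zero (S : Finset ℕ) (k : ℕ) : familyCount S (k + 1) 0 = 0 := by
  rw [familyCount]
  split_ifs <;> simp

theorem eq_of_forall_ne_mem_iff {J K : Finset ℕ} {j o : ℕ}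
    (h : ∀ i, i ≠ j → i ≠ o → (i ∈ J ↔ i ∈ K)) (hj : j ∈ J ↔ j ∈ K) (ho : o ∈ J ↔ o ∈ K) :
    J = K := by
  ext i
  by_cases hij : i = j
  · exact hij ▸ hj
  · by_cases hio : i = o
    · exact hio ▸ ho
    · exact h i hij hio

/-- The arrangements to which `joinWords (k + 1) j o` may be applied if `k + 1` has to become a
pinnacle: the two words to be joined are nonempty. -/
theorem setOf_joinable_of_mem {S I : Finset ℕ} {k j o : ℕ} (hj : j ∈ I) (hS : k + 1 ∈ S) :
    {f | ∃ J, IsArrangement S k J f ∧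
      (∀ i, i ≠ j → i ≠ o → (i ∈ J ↔ i ∈ I)) ∧ ((j ∈ J ∧ o ∈ J) ↔ k + 1 ∈ S)} =
    {f | IsArrangement S k (insert o I) f} := by
  ext f
  constructor
  · rintro ⟨J, hf, h1, h2⟩
    obtain ⟨hjJ, hoJ⟩ := h2.2 hS
    have : J = insert o I :=
      eq_of_forall_ne_mem_iff (j := j) (o := o) (fun i hi hi' => by simp [h1 i hi hi', hi'])
        (by simp [hj, hjJ]) (by simp [hoJ])
    exact this ▸ hf
  · exact fun hf => ⟨_, hf, fun i hi hi' => by simp [hi'], by simp [hj, hS]⟩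

/-- The arrangements to which `joinWords (k + 1) j o` may be applied if `k + 1` must not become a
pinnacle: at most one of the two words to be joined is nonempty. -/
theorem setOf_joinable_of_notMem {S I : Finset ℕ} {k j o : ℕ} (hj : j ∈ I) (ho : o ∉ I)
    (hS : k + 1 ∉ S) :
    {f | ∃ J, IsArrangement S k J f ∧
      (∀ i, i ≠ j → i ≠ o → (i ∈ J ↔ i ∈ I)) ∧ ((j ∈ J ∧ o ∈ J) ↔ k + 1 ∈ S)} =
    {f | IsArrangement S k (I.erase j) f} ∪ ({f | IsArrangement S k I f} ∪
      {f | IsArrangement S k (insert o (I.erase j)) f}) := by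
  have hjo : j ≠ o := by rintro rfl; exact ho hj
  ext f
  constructor
  · rintro ⟨J, hf, h1, h2⟩
    by_cases hjJ : j ∈ J
    · have hoJ : o ∉ J := fun h => hS (h2.1 ⟨hjJ, h⟩)
      have : J = I := eq_of_forall_ne_mem_iff h1 (by simp [hj, hjJ]) (by simp [ho, hoJ])
      exact Or.inr (Or.inl (this ▸ hf))
    · by_cases hoJ : o ∈ J
      · have : J = insert o (I.erase j) :=
          eq_of_forall_ne_mem_iff (j := j) (o := o) (fun i hi hi' => by simp [h1 i hi hi', hi, hi'])
            (by simp [hjJ, hjo]) (by simp [hoJ])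
        exact Or.inr (Or.inr (this ▸ hf))
      · have : J = I.erase j :=
          eq_of_forall_ne_mem_iff (j := j) (o := o) (fun i hi hi' => by simp [h1 i hi hi', hi])
            (by simp [hjJ]) (by simp [ho, hoJ])
        exact Or.inl (this ▸ hf)
  · rintro (hf | hf | hf)
    · exact ⟨_, hf, fun i hi hi' => by simp [hi], by simp [hS]⟩
    · exact ⟨_, hf, fun i hi hi' => Iff.rfl, by simp [hS, ho]⟩
    · exact ⟨_, hf, fun i hi hi' => by simp [hi, hi'], by simp [hS, hjo]⟩

theorem disjoint_setOf_isArrangement {S J K : Finset ℕ} {k : ℕ} (h : J ≠ K) :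
    Disjoint {f | IsArrangement S k J f} {f | IsArrangement S k K f} := by
  refine Set.disjoint_left.2 fun f hf hf' => h ?_
  ext i
  rw [← hf.nonempty_iff, hf'.nonempty_iff]

open Nat in
/-- Arrangements label the words by `I`, whence the factor `|I|!`. -/
theorem encard_isArrangement (S : Finset ℕ) (k : ℕ) (I : Finset ℕ) :
    {f | IsArrangement S k I f}.encard = ((I.card ! * familyCount S k I.card : ℕ) : ℕ∞) := by
  induction k generalizing I with
  | zero =>
    have key : ∀ f, IsArrangement S 0 I f ↔ I = ∅ ∧ f = fun _ => [] := by
      intro f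
      constructor
      · intro hf
        have h : ∀ i, f i = [] := fun i => List.eq_nil_iff_forall_not_mem.2 fun x hx => by
          have := (hf.letters x).1 ⟨i, hx⟩
          omega
        exact ⟨Finset.eq_empty_of_forall_notMem fun i hi => (hf.nonempty_iff i).2 hi (h i),
          funext h⟩
      · rintro ⟨rfl, rfl⟩
        refine ⟨by simp, by simp, by simp, fun x => ?_, fun x => ?_⟩
        · simp; omega
        · simp only [not_isPinnacle_nil, exists_const, false_iff]; omega
    rcases I.eq_empty_or_nonempty with rfl | hI
    · simp [key, familyCount]
    · obtain ⟨c, hc⟩ := Nat.exists_eq_succ_of_ne_zero (Finset.card_pos.2 hI).ne'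
      simp [key, hI.ne_empty, hc, familyCount]
  | succ k ih =>
    obtain ⟨o, ho⟩ := Infinite.exists_notMem_finset I
    have hunion : {f | IsArrangement S (k + 1) I f} =
        ⋃ j ∈ (I : Set ℕ), {f | IsArrangement S (k + 1) I f ∧ k + 1 ∈ f j} := by
      ext f
      simp only [Set.mem_ofPred_eq, Set.mem_iUnion, exists_prop]
      constructor
      · intro hf
        obtain ⟨j, hj⟩ := (hf.letters (k + 1)).2 ⟨by omega, le_rfl⟩
        exact ⟨j, (hf.nonempty_iff j).1 (List.ne_nil_of_mem hj), hf, hj⟩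
      · rintro ⟨j, -, hf, -⟩
        exact hf
    have hdisj : (I : Set ℕ).PairwiseDisjoint
        fun j => {f | IsArrangement S (k + 1) I f ∧ k + 1 ∈ f j} := by
      intro i _ j _ hij
      refine Set.disjoint_left.2 ?_
      rintro f ⟨hf, hi⟩ ⟨-, hj⟩
      exact hij (hf.unique _ _ _ hi hj)
    have hpiece : ∀ j ∈ I, {f | IsArrangement S (k + 1) I f ∧ k + 1 ∈ f j} =
        joinWords (k + 1) j o '' {f | ∃ J, IsArrangement S k J f ∧
          (∀ i, i ≠ j → i ≠ o → (i ∈ J ↔ i ∈ I)) ∧ ((j ∈ J ∧ o ∈ J) ↔ k + 1 ∈ S)} := by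
      intro j hj
      have hjo : j ≠ o := by rintro rfl; exact ho hj
      ext g
      constructor
      · rintro ⟨hg, hgj⟩
        obtain ⟨f, J, hf, rfl, h⟩ := hg.exists_joinWords_eq hgj ho
        exact ⟨f, ⟨J, hf, h⟩, rfl⟩
      · rintro ⟨f, ⟨J, hf, h1, h2⟩, rfl⟩
        exact ⟨hf.join hjo hj ho h1 h2, by simp [joinWords_left hjo]⟩
    have hcard : ∀ j ∈ I, {f | IsArrangement S (k + 1) I f ∧ k + 1 ∈ f j}.encard =
        (((I.card - 1)! * familyCount S (k + 1) I.card : ℕ) : ℕ∞) := by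
      intro j hj
      have hjo : j ≠ o := by rintro rfl; exact ho hj
      have hoe : o ∉ I.erase j := fun h => ho (Finset.mem_of_mem_erase h)
      obtain ⟨c, hc⟩ := Nat.exists_eq_succ_of_ne_zero (Finset.card_pos.2 ⟨j, hj⟩).ne'
      have hce : (I.erase j).card = c := by rw [Finset.card_erase_of_mem hj, hc]; rfl
      rw [hpiece j hj, Set.InjOn.encard_image]
      swap
      · refine (IsArrangement.joinWords_injOn hjo).mono ?_
        rintro f ⟨J, hf, -⟩ i
        exact hf.succ_notMem i
      by_cases hS : k + 1 ∈ S
      · rw [setOf_joinable_of_mem hj hS, ih, Finset.card_insert_of_notMem ho, hc,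
          familyCount_succ_of_mem hS]
        congr 1
        simp only [Nat.succ_eq_add_one, Nat.factorial_succ, Nat.add_sub_cancel]
        ring
      · rw [setOf_joinable_of_notMem hj ho hS, Set.encard_union_eq, Set.encard_union_eq, ih, ih, ih,
          Finset.card_insert_of_notMem hoe, hce, hc, familyCount_succ_of_notMem hS]
        · norm_cast
          simp only [Nat.succ_eq_add_one, Nat.factorial_succ, Nat.add_sub_cancel]
          ring
        · exact disjoint_setOf_isArrangement fun h => ho (h ▸ Finset.mem_insert_self o _)
        · refine Set.disjoint_union_right.2 ⟨disjoint_setOf_isArrangement fun h => ?_,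
            disjoint_setOf_isArrangement fun h => ?_⟩
          · exact Finset.notMem_erase j I (h.symm ▸ hj)
          · exact hoe (h.symm ▸ Finset.mem_insert_self o _)
    rw [hunion, I.finite_toSet.encard_biUnion hdisj, finsum_mem_coe_finset,
      Finset.sum_congr rfl hcard, Finset.sum_const, nsmul_eq_mul, ← Nat.cast_mul, ← mul_assoc]
    rcases Nat.eq_zero_or_pos I.card with h0 | h0
    · simp [h0, familyCount_succ_zero]
    · rw [Nat.mul_factorial_pred h0.ne']

/-! ### Permutations as words -/

/-- The word `w(1) ⋯ w(n)` of a permutation, with letters in `[1, n]`. -/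
def permWord {n : ℕ} (w : Equiv.Perm (Fin n)) : List ℕ :=
  List.ofFn fun i => (w i : ℕ) + 1

theorem isPinnacle_permWord {n : ℕ} (w : Equiv.Perm (Fin n)) (x : ℕ) :
    IsPinnacle x (permWord w) ↔ x ∈ pinnacleSet w := by
  simp only [IsPinnacle, pinnacleSet, peakSet, Finset.mem_image, Finset.mem_filter,
    Finset.mem_univ, true_and]
  constructor
  · rintro ⟨a, b, h, hax, hbx⟩
    obtain ⟨m, hm, h⟩ := List.infix_iff_getElem?.1 h
    have h0 := h 0 (by simp)
    have h1 := h 1 (by simp)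
    have h2 := h 2 (by simp)
    simp only [permWord, List.getElem?_eq_some_iff, List.length_ofFn, List.getElem_ofFn,
      List.getElem_cons_zero, List.getElem_cons_succ] at h0 h1 h2
    obtain ⟨l0, h0⟩ := h0
    obtain ⟨l1, h1⟩ := h1
    obtain ⟨l2, h2⟩ := h2
    refine ⟨⟨1 + m, l1⟩, ⟨⟨0 + m, l0⟩, ⟨2 + m, l2⟩, ?_, ?_, ?_, ?_⟩, h1⟩
    · simp only; omega
    · simp only; omega
    · rw [Fin.lt_def]; omega
    · rw [Fin.lt_def]; omega
  · rintro ⟨i, ⟨a, b, hai, hib, ha, hb⟩, rfl⟩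
    refine ⟨(w a : ℕ) + 1, (w b : ℕ) + 1, ?_, by rw [Fin.lt_def] at ha; omega,
      by rw [Fin.lt_def] at hb; omega⟩
    have hb' := b.isLt
    refine List.infix_iff_getElem?.2 ⟨a, ?_, ?_⟩
    · simp only [permWord, List.length_cons, List.length_nil, List.length_ofFn]; omega
    · intro t ht
      simp only [List.length_cons, List.length_nil] at ht
      rw [List.getElem?_eq_some_iff]
      refine ⟨by simp only [permWord, List.length_ofFn]; omega, ?_⟩
      simp only [permWord, List.getElem_ofFn]
      obtain rfl | rfl | rfl : t = 0 ∨ t = 1 ∨ t = 2 := by omega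
      · simp
      · have : (⟨1 + a, by omega⟩ : Fin n) = i := Fin.ext (by simp only; omega)
        simp [this]
      · have : (⟨2 + a, by omega⟩ : Fin n) = b := Fin.ext (by simp only; omega)
        simp [this]

theorem permWord_injective (n : ℕ) : Function.Injective (permWord (n := n)) := by
  intro w w' h
  ext i
  have := congrFun (List.ofFn_injective h) i
  omega

theorem mem_permWord {n : ℕ} (w : Equiv.Perm (Fin n)) (x : ℕ) :
    x ∈ permWord w ↔ 1 ≤ x ∧ x ≤ n := by
  simp only [permWord, List.mem_ofFn]
  constructor
  · rintro ⟨i, rfl⟩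
    have := (w i).isLt
    omega
  · rintro ⟨h1, h2⟩
    exact ⟨w.symm ⟨x - 1, by omega⟩, by simp only [Equiv.apply_symm_apply]; omega⟩

theorem nodup_permWord {n : ℕ} (w : Equiv.Perm (Fin n)) : (permWord w).Nodup :=
  List.nodup_ofFn.2 fun i j h => w.injective (Fin.ext (by simpa using h))

theorem exists_permWord_eq {n : ℕ} {l : List ℕ} (hl : l.Nodup)
    (h : ∀ x, x ∈ l ↔ 1 ≤ x ∧ x ≤ n) : ∃ w : Equiv.Perm (Fin n), permWord w = l := by
  have hlen : l.length = n := by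
    rw [← List.toFinset_card_of_nodup hl,
      show l.toFinset = Finset.Icc 1 n by ext x; simp [h], Nat.card_Icc, Nat.add_sub_cancel]
  subst hlen
  have hb := fun i : Fin l.length => (h l[i]).1 (List.getElem_mem i.isLt)
  let φ : Fin l.length → Fin l.length := fun i => ⟨l[i] - 1, by have := hb i; omega⟩
  have hφ : Function.Injective φ := by
    intro i j hij
    have h1 := hb i
    have h2 := hb j
    have : l[i] = l[j] := by
      have : l[i] - 1 = l[j] - 1 := congrArg Fin.val hij
      omega
    exact Fin.ext ((hl.getElem_inj_iff).1 this)
  refine ⟨Equiv.ofBijective φ (Finite.injective_iff_bijective.1 hφ), ?_⟩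
  refine List.ext_getElem (by simp [permWord]) fun i h1 h2 => ?_
  have := hb ⟨i, h2⟩
  simp only [permWord, List.getElem_ofFn, Equiv.ofBijective_apply, φ]
  simp only [Fin.getElem_fin] at this ⊢
  omega

theorem pinnacleSet_subset {n : ℕ} (w : Equiv.Perm (Fin n)) : pinnacleSet w ⊆ Finset.Icc 1 n :=
  fun x hx => Finset.mem_Icc.2 ((mem_permWord w x).1 ((isPinnacle_permWord w x).2 hx).mem)

theorem pinnacleCount_eq_familyCount {S : Finset ℕ} {n : ℕ} (hn : 0 < n)
    (hS : S ⊆ Finset.Icc 1 n) : pinnacleCount S n = familyCount S n 1 := by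
  have hcount := encard_isArrangement S n {0}
  set φ : Equiv.Perm (Fin n) → ℕ → List ℕ := fun w => Function.update (fun _ => []) 0 (permWord w)
  have hinj : Function.Injective φ := fun w w' h => by
    have := congrFun h 0
    simp only [φ, Function.update_self] at this
    exact permWord_injective n this
  have himage : {f | IsArrangement S n {0} f} =
      φ '' ((Finset.univ.filter fun w : Equiv.Perm (Fin n) => pinnacleSet w = S :
        Finset (Equiv.Perm (Fin n))) : Set (Equiv.Perm (Fin n))) := by
    have hzero : ∀ (l : List ℕ) (i : ℕ) (P : List ℕ → Prop), ¬ P [] →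
        (P (Function.update (fun _ => []) 0 l i) ↔ i = 0 ∧ P l) := by
      intro l i P hP
      by_cases hi : i = 0
      · subst hi; simp
      · simp [hi, hP]
    have hpinS : ∀ x, x ∈ S ↔ x ∈ S ∧ 1 ≤ x ∧ x ≤ n := fun x =>
      ⟨fun h => ⟨h, Finset.mem_Icc.1 (hS h)⟩, And.left⟩
    ext f
    simp only [Finset.coe_filter, Finset.mem_univ, true_and, Set.mem_image, Set.mem_ofPred_eq]
    constructor
    · intro hf
      have h0 : ∀ i, i ≠ 0 → f i = [] := fun i hi => by
        by_contra h
        exact hi (Finset.mem_singleton.1 ((hf.nonempty_iff i).1 h))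
      have hex : ∀ P : List ℕ → Prop, ¬ P [] → ((∃ i, P (f i)) ↔ P (f 0)) := by
        refine fun P hP => ⟨?_, fun h => ⟨0, h⟩⟩
        rintro ⟨i, hi⟩
        by_cases h : i = 0
        · exact h ▸ hi
        · exact absurd (h0 i h ▸ hi) hP
      obtain ⟨w, hw⟩ := exists_permWord_eq (hf.nodup 0) fun x =>
        (hex (x ∈ ·) (by simp)).symm.trans (hf.letters x)
      refine ⟨w, ?_, ?_⟩
      · ext x
        rw [← isPinnacle_permWord, hw, hpinS, ← hf.pinnacles,
          hex (IsPinnacle x) (not_isPinnacle_nil x)]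
      · funext i
        by_cases hi : i = 0
        · subst hi; simp [φ, hw]
        · simp [φ, hi, h0 i hi]
    · rintro ⟨w, hw, rfl⟩
      have h1 : permWord w ≠ [] := List.ne_nil_of_mem ((mem_permWord w 1).2 ⟨le_rfl, hn⟩)
      refine ⟨fun i => ?_, fun i => ?_, fun i j x hi hj => ?_, fun x => ?_, fun x => ?_⟩
      · rw [hzero _ _ (· ≠ []) (by simp)]; simp [h1]
      · by_cases hi : i = 0
        · subst hi; simp [φ, nodup_permWord]
        · simp [φ, hi]
      · rw [hzero _ _ (x ∈ ·) (by simp)] at hi hj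
        rw [hi.1, hj.1]
      · simp only [φ, hzero _ _ (x ∈ ·) (List.not_mem_nil), exists_eq_left, mem_permWord]
      · simp only [φ, hzero _ _ (IsPinnacle x) (not_isPinnacle_nil x), exists_eq_left,
          isPinnacle_permWord, hw]
        exact hpinS x
  rw [himage, hinj.encard_image, Set.encard_coe_eq_coe_finsetCard] at hcount
  simpa [pinnacleCount] using hcount

/-! ### Bounds for the counts -/

theorem card_inter_Icc_succ (S : Finset ℕ) (k : ℕ) :
    (S ∩ Finset.Icc 1 (k + 1)).card =
      (S ∩ Finset.Icc 1 k).card + if k + 1 ∈ S then 1 else 0 := by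
  rw [← Finset.insert_Icc_right_eq_Icc_add_one (by omega)]
  split_ifs with h
  · rw [Finset.inter_insert_of_mem h, Finset.card_insert_of_notMem (by simp)]
  · rw [Finset.inter_insert_of_notMem h, Nat.add_zero]

/-- Every letter other than those that start a new word contributes a factor of at least `2`, and
the number of words that are started is `c` plus the number of pinnacles. -/
theorem two_pow_le_familyCount (S : Finset ℕ) (k c : ℕ) (h : familyCount S k c ≠ 0) :
    2 ^ k ≤ familyCount S k c * 2 ^ (c + (S ∩ Finset.Icc 1 k).card) := by
  induction k generalizing c with
  | zero =>
    rw [pow_zero]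
    exact Nat.one_le_iff_ne_zero.2 (mul_ne_zero h (by positivity))
  | succ k ih =>
    rw [card_inter_Icc_succ]
    by_cases hS : k + 1 ∈ S
    · rw [familyCount_succ_of_mem hS] at h ⊢
      have h' := ih (c + 1) (right_ne_zero_of_mul h)
      have hc : 1 ≤ c := Nat.one_le_iff_ne_zero.2 (right_ne_zero_of_mul (left_ne_zero_of_mul h))
      have hc2 : 2 ≤ (c + 1) * c := by nlinarith
      rw [if_pos hS, pow_succ]
      calc 2 ^ k * 2
          ≤ (familyCount S k (c + 1) * 2 ^ (c + 1 + (S ∩ Finset.Icc 1 k).card)) *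
              ((c + 1) * c) := Nat.mul_le_mul h' hc2
        _ = _ := by ring
    · cases c with
      | zero => exact absurd (familyCount_succ_zero S k) h
      | succ c =>
        rw [familyCount_succ_of_notMem hS] at h ⊢
        rw [if_neg hS, Nat.add_zero, add_mul]
        by_cases h0 : familyCount S k c = 0
        · have h1 : familyCount S k (c + 1) ≠ 0 := fun h1 => h (by simp [h0, h1])
          have h' := ih (c + 1) h1
          rw [pow_succ]
          calc 2 ^ k * 2
              ≤ (familyCount S k (c + 1) * 2 ^ (c + 1 + (S ∩ Finset.Icc 1 k).card)) *
                  (2 * (c + 1)) := Nat.mul_le_mul h' (by omega)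
            _ = 2 * (c + 1) * familyCount S k (c + 1) *
                  2 ^ (c + 1 + (S ∩ Finset.Icc 1 k).card) := by ring
            _ ≤ _ := Nat.le_add_left _ _
        · have h' := ih c h0
          rw [pow_succ]
          calc 2 ^ k * 2
              ≤ (familyCount S k c * 2 ^ (c + (S ∩ Finset.Icc 1 k).card)) * 2 :=
                Nat.mul_le_mul_right 2 h'
            _ = familyCount S k c * 2 ^ (c + 1 + (S ∩ Finset.Icc 1 k).card) := by ring
            _ ≤ _ := Nat.le_add_right _ _

open Nat in
/-- Among all choices of `s` pinnacles, the count is largest when they are the `s` largest letters: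
the right-hand side is the left-hand side for this choice, by
`familyCount_maximalPinnacles_add`. The factor `(e + 1)! e!` turns the step in which a pinnacle joins
two words into an equality. -/
theorem familyCount_le_of_card (S : Finset ℕ) (k m s e : ℕ)
    (hs : (S ∩ Finset.Icc 1 k).card = s) (hk : k = m + s) :
    (e + 1)! * e ! * familyCount S k (e + 1) ≤
      (e + 1 + s)! * (e + s)! * familyCount ∅ m (e + 1 + s) := by
  induction k generalizing m s e with
  | zero =>
    obtain ⟨rfl, rfl⟩ : m = 0 ∧ s = 0 := by omega
    simp [familyCount]
  | succ k ih =>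
    rw [card_inter_Icc_succ] at hs
    by_cases hS : k + 1 ∈ S
    · rw [if_pos hS] at hs
      obtain ⟨s, rfl⟩ : ∃ t, s = t + 1 := ⟨s - 1, by omega⟩
      have h := ih m s (e + 1) (by omega) (by omega)
      rw [familyCount_succ_of_mem hS]
      calc (e + 1)! * e ! * ((e + 1 + 1) * (e + 1) * familyCount S k (e + 1 + 1))
          = (e + 1 + 1)! * (e + 1)! * familyCount S k (e + 1 + 1) := by
            rw [Nat.factorial_succ (e + 1), Nat.factorial_succ e]; ring
        _ ≤ _ := h
        _ = _ := by
          rw [show e + 1 + 1 + s = e + 1 + (s + 1) by ring, show e + 1 + s = e + (s + 1) by ring]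
    · rw [if_neg hS, Nat.add_zero] at hs
      have hle : (S ∩ Finset.Icc 1 k).card ≤ k := by
        simpa using Finset.card_le_card (Finset.inter_subset_right (s₁ := S) (s₂ := Finset.Icc 1 k))
      obtain ⟨m, rfl⟩ : ∃ t, m = t + 1 := ⟨m - 1, by omega⟩
      have h1 := ih m s e hs (by omega)
      have h0 : (e + 1)! * e ! * familyCount S k e ≤
          (e + 1 + s)! * (e + s)! * familyCount ∅ m (e + s) := by
        cases e with
        | zero =>
          cases k with
          | zero =>
            obtain ⟨rfl, rfl⟩ : m = 0 ∧ s = 0 := by omega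
            simp [familyCount]
          | succ k => simp [familyCount_succ_zero]
        | succ e =>
          have h := ih m s e hs (by omega)
          calc (e + 1 + 1)! * (e + 1)! * familyCount S k (e + 1)
              = (e + 1 + 1) * (e + 1) * ((e + 1)! * e ! * familyCount S k (e + 1)) := by
                rw [Nat.factorial_succ (e + 1), Nat.factorial_succ e]; ring
            _ ≤ (e + 1 + s + 1) * (e + s + 1) *
                  ((e + 1 + s)! * (e + s)! * familyCount ∅ m (e + 1 + s)) :=
                Nat.mul_le_mul (Nat.mul_le_mul (by omega) (by omega)) h
            _ = _ := by
                rw [show e + 1 + 1 + s = e + 1 + s + 1 by ring,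
                  show e + 1 + s = e + s + 1 by ring, Nat.factorial_succ (e + s + 1),
                  Nat.factorial_succ (e + s)]
                ring
      rw [familyCount_succ_of_notMem hS, show e + 1 + s = e + s + 1 by ring,
        familyCount_succ_of_notMem (Finset.notMem_empty _)]
      rw [show e + 1 + s = e + s + 1 by ring] at h0 h1
      calc (e + 1)! * e ! * (familyCount S k e + 2 * (e + 1) * familyCount S k (e + 1))
          = (e + 1)! * e ! * familyCount S k e +
              2 * (e + 1) * ((e + 1)! * e ! * familyCount S k (e + 1)) := by ring
        _ ≤ (e + s + 1)! * (e + s)! * familyCount ∅ m (e + s) +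
              2 * (e + s + 1) *
                ((e + s + 1)! * (e + s)! * familyCount ∅ m (e + s + 1)) :=
            Nat.add_le_add h0 (Nat.mul_le_mul (by omega) h1)
        _ = _ := by ring

/-- A nonempty block of size `b` can be arranged without pinnacles in `2 ^ (b - 1)` ways. -/
theorem familyCount_empty (m c : ℕ) :
    familyCount ∅ m c = 2 ^ (m - c) * Nat.stirlingSecond m c := by
  induction m generalizing c with
  | zero => cases c <;> simp [familyCount]
  | succ m ih =>
    cases c with
    | zero => simp [familyCount_succ_zero]
    | succ c =>
      rw [familyCount_succ_of_notMem (Finset.notMem_empty _), ih, ih,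
        Nat.stirlingSecond_succ_succ, Nat.add_sub_add_right]
      rcases Nat.lt_or_ge m (c + 1) with h | h
      · rw [Nat.stirlingSecond_eq_zero_of_lt h]; simp
      · rw [show m - c = m - (c + 1) + 1 by omega]; ring

theorem familyCount_add {S : Finset ℕ} {m : ℕ} (hm : 0 < m) (hS : S ⊆ Finset.Icc 1 m) (r : ℕ) :
    familyCount S (m + r) 1 = 2 ^ r * familyCount S m 1 := by
  induction r with
  | zero => simp
  | succ r ih =>
    have hr : m + r + 1 ∉ S := fun h => by
      have := Finset.mem_Icc.1 (hS h)
      omega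
    obtain ⟨t, ht⟩ : ∃ t, m + r = t + 1 := ⟨m + r - 1, by omega⟩
    rw [← Nat.add_assoc, familyCount_succ_of_notMem hr, ih, ht, familyCount_succ_zero]
    ring

theorem IsAdmissible.familyCount_ne_zero {S : Finset ℕ} {n : ℕ} (hadm : IsAdmissible S)
    (hS : S ⊆ Finset.Icc 1 n) (hne : S.Nonempty) : familyCount S n 1 ≠ 0 := by
  obtain ⟨m, w, hw⟩ := hadm
  have hSm : S ⊆ Finset.Icc 1 m := hw ▸ pinnacleSet_subset w
  have hpos : ∀ N, S ⊆ Finset.Icc 1 N → 0 < N := by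
    intro N hN
    obtain ⟨x, hx⟩ := hne
    have := Finset.mem_Icc.1 (hN hx)
    omega
  have hm : familyCount S m 1 ≠ 0 := by
    rw [← pinnacleCount_eq_familyCount (hpos m hSm) hSm]
    exact Finset.card_ne_zero_of_mem (Finset.mem_filter.2 ⟨Finset.mem_univ w, hw⟩)
  rcases Nat.le_total m n with h | h
  · obtain ⟨r, rfl⟩ := Nat.exists_eq_add_of_le h
    rw [familyCount_add (hpos m hSm) hSm]
    positivity
  · obtain ⟨r, rfl⟩ := Nat.exists_eq_add_of_le h
    rw [familyCount_add (hpos n hS) hS] at hm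
    exact right_ne_zero_of_mul hm

theorem isAdmissible_of_pinnacleCount_ne_zero {S : Finset ℕ} {n : ℕ} (h : pinnacleCount S n ≠ 0) :
    IsAdmissible S := by
  obtain ⟨w, hw⟩ := Finset.card_ne_zero.1 h
  exact ⟨n, w, (Finset.mem_filter.1 hw).2⟩

open Nat in
theorem pinnacleCount_le {S : Finset ℕ} {n : ℕ} (hn : 0 < n) (hS : S ⊆ Finset.Icc 1 n) :
    pinnacleCount S n ≤ S.card ! * (S.card + 1)! * 2 ^ (n - 2 * S.card - 1) *
      Nat.stirlingSecond (n - S.card) (S.card + 1) := by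
  have hcard : S.card ≤ n := by simpa using Finset.card_le_card hS
  have h := familyCount_le_of_card S n (n - S.card) S.card 0
    (by rw [Finset.inter_eq_left.2 hS]) (by omega)
  rw [familyCount_empty, ← pinnacleCount_eq_familyCount hn hS] at h
  simp only [Nat.zero_add, Nat.factorial_one, Nat.factorial_zero, Nat.one_mul] at h
  rw [show 1 + S.card = S.card + 1 by ring,
    show n - S.card - (S.card + 1) = n - 2 * S.card - 1 by omega] at h
  calc _ ≤ _ := h
    _ = _ := by ring

/-! ### The extremal pinnacle sets -/

theorem minimalPinnacles_subset {d n : ℕ} (h : 2 * d < n) :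
    minimalPinnacles d ⊆ Finset.Icc 1 n := by
  intro x hx
  simp only [minimalPinnacles, Finset.mem_image, Finset.mem_Icc] at hx ⊢
  omega

theorem card_minimalPinnacles (d : ℕ) : (minimalPinnacles d).card = d := by
  rw [minimalPinnacles, Finset.card_image_of_injective _ fun a b h => by omega]
  simp

theorem familyCount_minimalPinnacles {d i : ℕ} (hi : i ≤ d) :
    familyCount (minimalPinnacles d) (2 * i + 1) 1 = 2 ^ i ∧
      ∀ c, familyCount (minimalPinnacles d) (2 * i + 1) (c + 2) = 0 := by
  induction i with
  | zero =>
    have h1 : 0 + 1 ∉ minimalPinnacles d := by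
      simp only [minimalPinnacles, Finset.mem_image, Finset.mem_Icc]; omega
    refine ⟨?_, fun c => ?_⟩
    · rw [familyCount_succ_of_notMem h1]; simp [familyCount]
    · rw [familyCount_succ_of_notMem h1]; simp [familyCount]
  | succ i ih =>
    obtain ⟨ih1, ih2⟩ := ih (by omega)
    have heven : 2 * i + 1 + 1 ∉ minimalPinnacles d := by
      simp only [minimalPinnacles, Finset.mem_image, Finset.mem_Icc]; omega
    have hodd : 2 * i + 1 + 1 + 1 ∈ minimalPinnacles d := by
      simp only [minimalPinnacles, Finset.mem_image, Finset.mem_Icc]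
      exact ⟨i + 1, by omega, by omega⟩
    rw [show 2 * (i + 1) + 1 = 2 * i + 1 + 1 + 1 by ring]
    refine ⟨?_, fun c => ?_⟩
    · rw [familyCount_succ_of_mem hodd, familyCount_succ_of_notMem heven, ih1, ih2 0]
      ring
    · rw [familyCount_succ_of_mem hodd, familyCount_succ_of_notMem heven, ih2 c, ih2 (c + 1)]
      simp

theorem pinnacleCount_minimalPinnacles {d n : ℕ} (h : 2 * d < n) :
    pinnacleCount (minimalPinnacles d) n = 2 ^ (n - d - 1) := by
  rw [pinnacleCount_eq_familyCount (by omega) (minimalPinnacles_subset h)]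
  obtain ⟨r, rfl⟩ := Nat.exists_eq_add_of_le (Nat.succ_le_of_lt h)
  rw [Nat.succ_eq_add_one, familyCount_add (by omega) (minimalPinnacles_subset (by omega)),
    (familyCount_minimalPinnacles le_rfl).1, ← pow_add]
  congr 1
  omega

theorem maximalPinnacles_subset (n d : ℕ) : maximalPinnacles n d ⊆ Finset.Icc 1 n :=
  Finset.Icc_subset_Icc_left (by omega)

theorem card_maximalPinnacles {d n : ℕ} (h : d ≤ n) : (maximalPinnacles n d).card = d := by
  rw [maximalPinnacles, Nat.card_Icc]
  omega

theorem familyCount_maximalPinnacles_of_le {d n k : ℕ} (hk : k ≤ n - d) (c : ℕ) :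
    familyCount (maximalPinnacles n d) k c = familyCount ∅ k c := by
  induction k generalizing c with
  | zero => cases c <;> simp [familyCount]
  | succ k ih =>
    have hS : k + 1 ∉ maximalPinnacles n d := by
      rw [maximalPinnacles, Finset.mem_Icc]; omega
    cases c with
    | zero => simp [familyCount_succ_zero]
    | succ c =>
      rw [familyCount_succ_of_notMem hS, familyCount_succ_of_notMem (Finset.notMem_empty _),
        ih (by omega), ih (by omega)]

open Nat in
theorem familyCount_maximalPinnacles_add {d n i : ℕ} (hd : d ≤ n) (hi : i ≤ d) (e : ℕ) :
    (e + 1)! * e ! * familyCount (maximalPinnacles n d) (n - d + i) (e + 1) =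
      (e + 1 + i)! * (e + i)! * familyCount ∅ (n - d) (e + 1 + i) := by
  induction i generalizing e with
  | zero => simp [familyCount_maximalPinnacles_of_le le_rfl]
  | succ i ih =>
    have hS : n - d + i + 1 ∈ maximalPinnacles n d := by
      rw [maximalPinnacles, Finset.mem_Icc]; omega
    have h := ih (by omega) (e + 1)
    rw [show e + 1 + 1 + i = e + 1 + (i + 1) by ring, show e + 1 + i = e + (i + 1) by ring] at h
    rw [← Nat.add_assoc (n - d), familyCount_succ_of_mem hS, ← h, Nat.factorial_succ (e + 1),
      Nat.factorial_succ e]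
    ring

open Nat in
theorem pinnacleCount_maximalPinnacles {d n : ℕ} (h : 2 * d < n) :
    pinnacleCount (maximalPinnacles n d) n =
      d ! * (d + 1)! * 2 ^ (n - 2 * d - 1) * Nat.stirlingSecond (n - d) (d + 1) := by
  rw [pinnacleCount_eq_familyCount (by omega) (maximalPinnacles_subset n d)]
  have h' := familyCount_maximalPinnacles_add (n := n) (by omega) (le_refl d) 0
  rw [familyCount_empty, show n - d + d = n by omega] at h'
  simp only [Nat.zero_add, Nat.factorial_one, Nat.factorial_zero, Nat.one_mul] at h'
  rw [h', show 1 + d = d + 1 by ring, show n - d - (d + 1) = n - 2 * d - 1 by omega]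
  ring

theorem theorem1p4 (d n : ℕ) (hd : 0 < d) (hdn : 2 * d < n) :
    (∀ S : Finset ℕ, S ⊆ Finset.Icc 1 n → IsAdmissible S → S.card = d →
      2 ^ (n - d - 1) ≤ pinnacleCount S n ∧
      pinnacleCount S n ≤
        Nat.factorial d * Nat.factorial (d + 1) * 2 ^ (n - 2 * d - 1) *
          Nat.stirlingSecond (n - d) (d + 1)) ∧
    (minimalPinnacles d ⊆ Finset.Icc 1 n ∧ IsAdmissible (minimalPinnacles d) ∧
      (minimalPinnacles d).card = d ∧
      pinnacleCount (minimalPinnacles d) n = 2 ^ (n - d - 1)) ∧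
    (maximalPinnacles n d ⊆ Finset.Icc 1 n ∧ IsAdmissible (maximalPinnacles n d) ∧
      (maximalPinnacles n d).card = d ∧
      pinnacleCount (maximalPinnacles n d) n =
        Nat.factorial d * Nat.factorial (d + 1) * 2 ^ (n - 2 * d - 1) *
          Nat.stirlingSecond (n - d) (d + 1)) := by
  have hn : 0 < n := by omega
  have hmin := pinnacleCount_minimalPinnacles hdn
  have hmax := pinnacleCount_maximalPinnacles hdn
  refine ⟨fun S hS hadm hcard => ⟨?_, ?_⟩,
    ⟨minimalPinnacles_subset hdn, ?_, card_minimalPinnacles d, hmin⟩,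
    ⟨maximalPinnacles_subset n d, ?_, card_maximalPinnacles (by omega), hmax⟩⟩
  · have hne : S.Nonempty := Finset.card_pos.1 (by omega)
    have h := two_pow_le_familyCount S n 1 (hadm.familyCount_ne_zero hS hne)
    rw [Finset.inter_eq_left.2 hS, hcard, ← pinnacleCount_eq_familyCount hn hS] at h
    refine Nat.le_of_mul_le_mul_right (c := 2 ^ (1 + d)) ?_ (by positivity)
    rwa [← pow_add, show n - d - 1 + (1 + d) = n by omega]
  · simpa only [hcard] using pinnacleCount_le hn hS
  · exact isAdmissible_of_pinnacleCount_ne_zero (n := n) (by rw [hmin]; positivity)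
  · -- The count is at least the one of `minimalPinnacles d` by the upper bound, hence nonzero.
    have h := pinnacleCount_le hn (minimalPinnacles_subset hdn)
    rw [card_minimalPinnacles, hmin, ← hmax] at h
    exact isAdmissible_of_pinnacleCount_ne_zero (n := n)
      (Nat.pos_iff_ne_zero.1 (lt_of_lt_of_le (by positivity) h))
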